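/- Let $k\ge 1$ be an integer and $p$ a prime. Let $G$ be a nontrivial nilpotent $p$-group of class at most $k$ (that is, $G_{k+1}=\{e\}$, where $G_1=G$ and $G_{n+1}=[G_n,G]$). Let $\{x_1,\ldots,x_r\}$ be a minimal generating set of $G$ with $r$ elements (it generates $G$ and no proper subset of it does), let $p^{\alpha_i}$ be the order of $x_i$, and suppose $\alpha_1\le\cdots\le\alpha_r$. If $G$ is capable, i.e. $G\cong H/Z(H)$ for some group $H$, where $Z(H)$ is the center of $H$, then $r>1$ and $$\alpha_r\le\alpha_{r-1}+\left\lfloor\frac{k-1}{p-1}\right\rfloor.$$ In particular, if $k<p$, then $\alpha_r=\alpha_{r-1}$. -/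

import Mathlib

universe u v

/-- A group `G` is capable if `G ≅ H / Z(H)` for some group `H`. The group `H` may live in a
universe `v` different from that of `G`. -/
def IsCapable (G : Type u) [Group G] : Prop :=
  ∃ (H : Type v) (_ : Group H), Nonempty (G ≃* H ⧸ Subgroup.center H)

/-- `x 0, …, x (r - 1)` is a repetition-free enumeration of a minimal generating set of `G`:
the set `{x 0, …, x (r - 1)}` generates `G` and no proper subset of it does. -/
def IsMinimalGenerating {G : Type u} [Group G] {r : ℕ} (x : Fin r → G) : Prop :=
  Function.Injective x ∧ Minimal (fun S : Set G => Subgroup.closure S = ⊤) (Set.range x)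

open Subgroup
open scoped commutatorElement

/-! ### Filtrations and polynomial sequences -/

/-! Write $G=H/Z(H)$, so that $H$ has class at most $k+1$, and lift the generators to $H$. For a
lift $b$ of some $x_i$ with $i<r$, $b^{p^m}$ is central, where $m=\alpha_{r-1}$. By
`commute_pow_of_pow_mem_center`, raising any $a\in H$ to the power $p^{m+\lfloor
(k-1)/(p-1)\rfloor}$ gives an element commuting with $b$. For $a$ a lift of $x_r$, this power
commutes with all the lifts, hence is central, which bounds the order of $x_r$.

The key estimate is `pow_mem_relLowerCentralSeries`: with $N_0$ the normal closure of $b$ and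
$N_{j+1}=[N_j,H]$, the power $p^{m+\lfloor t/(p-1)\rfloor}$ sends $N_{w+1}$ into $N_{w+t+2}$. It
combines a Hall–Petrescu expansion of $(xy)^n$, with error terms $c^{\binom ni}$, and the
$p$-divisibility of $\binom ni$. The expansion follows from the Lazard–Leibman principle that
polynomial sequences in a filtered group form a group. -/

/-- A descending sequence of subgroups `F` with `⁅F i, F j⁆ ≤ F (i + j)`. -/
structure IsGroupFiltration {A : Type*} [Group A] (F : ℕ → Subgroup A) : Prop where
  antitone : Antitone F
  commutator_mem : ∀ {i j : ℕ} {a b : A}, a ∈ F i → b ∈ F j → ⁅a, b⁆ ∈ F (i + j)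

namespace IsGroupFiltration

variable {A : Type*} [Group A] {F : ℕ → Subgroup A}

theorem conj_mem (hF : IsGroupFiltration F) {i j : ℕ} {a b : A} (ha : a ∈ F j) (hb : b ∈ F i) :
    a * b * a⁻¹ ∈ F i := by
  have h : ⁅a, b⁆ ∈ F i := hF.antitone (Nat.le_add_left i j) (hF.commutator_mem ha hb)
  simpa [commutatorElement_def, mul_assoc] using mul_mem h hb

theorem conj_mem' (hF : IsGroupFiltration F) {i j : ℕ} {a b : A} (ha : a ∈ F j) (hb : b ∈ F i) :
    a⁻¹ * b * a ∈ F i := by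
  simpa using hF.conj_mem (inv_mem ha) hb

end IsGroupFiltration

/-- The forward difference `n ↦ (g n)⁻¹ * g (n + 1)` of a sequence in a group. -/
def mulDiff {G : Type*} [Group G] (g : ℕ → G) : ℕ → G := fun n => (g n)⁻¹ * g (n + 1)

section mulDiff

variable {G : Type*} [Group G]

theorem mulDiff_one : mulDiff (1 : ℕ → G) = 1 := by
  ext n; simp [mulDiff]

theorem mulDiff_mul (f g : ℕ → G) :
    mulDiff (f * g) = g⁻¹ * mulDiff f * g * mulDiff g := by
  ext n; simp [mulDiff, mul_assoc]

theorem mulDiff_inv (f : ℕ → G) : mulDiff f⁻¹ = f * (mulDiff f)⁻¹ * f⁻¹ := by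
  ext n; simp [mulDiff, mul_assoc]

theorem mulDiff_commutator (f g : ℕ → G) :
    mulDiff ⁅f, g⁆ = ⁅f, g⁆⁻¹ * (f * ⁅mulDiff f, g⁆ * f⁻¹) * ⁅f, g⁆ *
      (g * ⁅f * mulDiff f, mulDiff g⁆ * g⁻¹) := by
  ext n; simp [mulDiff, commutatorElement_def, mul_assoc]

/-- The sequences of `P i` whose difference lies in `P (i + 1)`. -/
def diffRefine (P : ℕ → Subgroup (ℕ → G)) (hP : IsGroupFiltration P) (i : ℕ) :
    Subgroup (ℕ → G) where
  carrier := {g | g ∈ P i ∧ mulDiff g ∈ P (i + 1)}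
  one_mem' := ⟨one_mem _, by rw [mulDiff_one]; exact one_mem _⟩
  mul_mem' := by
    rintro f g ⟨hf, hf'⟩ ⟨hg, hg'⟩
    refine ⟨mul_mem hf hg, ?_⟩
    rw [mulDiff_mul]
    exact mul_mem (hP.conj_mem' hg hf') hg'
  inv_mem' := by
    rintro f ⟨hf, hf'⟩
    refine ⟨inv_mem hf, ?_⟩
    rw [mulDiff_inv]
    exact hP.conj_mem hf (inv_mem hf')

/-- By the Leibniz rule `mulDiff_commutator`, the difference of $[f,g]$ is a product of conjugates
of commutators in which one entry is a difference, hence one step deeper. -/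
theorem isGroupFiltration_diffRefine {P : ℕ → Subgroup (ℕ → G)} (hP : IsGroupFiltration P) :
    IsGroupFiltration (diffRefine P hP) where
  antitone := fun _ _ hij _ hg => ⟨hP.antitone hij hg.1, hP.antitone (by omega) hg.2⟩
  commutator_mem := by
    rintro i j f g ⟨hf, hf'⟩ ⟨hg, hg'⟩
    refine ⟨hP.commutator_mem hf hg, ?_⟩
    rw [mulDiff_commutator]
    have h₁ : ⁅mulDiff f, g⁆ ∈ P (i + j + 1) := by
      have := hP.commutator_mem hf' hg
      rwa [show i + 1 + j = i + j + 1 by omega] at this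
    have hff : f * mulDiff f ∈ P i := mul_mem hf (hP.antitone (Nat.le_succ i) hf')
    have h₂ : ⁅f * mulDiff f, mulDiff g⁆ ∈ P (i + j + 1) :=
      hP.commutator_mem (j := j + 1) hff hg'
    exact mul_mem (hP.conj_mem' (hP.commutator_mem hf hg) (hP.conj_mem hf h₁)) (hP.conj_mem hg h₂)

theorem isGroupFiltration_pi {F : ℕ → Subgroup G} (hF : IsGroupFiltration F) :
    IsGroupFiltration (fun i => Subgroup.pi Set.univ fun _ : ℕ => F i) where
  antitone := fun _ _ hij _ hg n hn => hF.antitone hij (hg n hn)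
  commutator_mem := fun ha hb n hn => hF.commutator_mem (ha n hn) (hb n hn)

/-- Sequences whose `d`-th differences lie in `F (i + d)` for all `d ≤ D`, as a filtration
indexed by `i`. -/
def polySeq (F : ℕ → Subgroup G) (hF : IsGroupFiltration F) :
    ℕ → {P : ℕ → Subgroup (ℕ → G) // IsGroupFiltration P}
  | 0 => ⟨_, isGroupFiltration_pi hF⟩
  | D + 1 => ⟨_, isGroupFiltration_diffRefine (polySeq F hF D).2⟩

variable {F : ℕ → Subgroup G} (hF : IsGroupFiltration F)

theorem apply_mem_of_mem_polySeq {D i : ℕ} {g : ℕ → G} (hg : g ∈ (polySeq F hF D).1 i) (n : ℕ) :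
    g n ∈ F i := by
  induction D with
  | zero => exact hg n (Set.mem_univ n)
  | succ D ih => exact ih hg.1

/-- Pascal's rule: differencing lowers $j$ by one while $i$ rises by one, so $i+j$ is preserved. -/
theorem pow_choose_mem_polySeq (D : ℕ) {i j : ℕ} {c : G} (hc : c ∈ F (i + j)) :
    (fun n : ℕ => c ^ n.choose j) ∈ (polySeq F hF D).1 i := by
  induction D generalizing i j with
  | zero => exact fun n _ => pow_mem (hF.antitone (Nat.le_add_right i j) hc) _
  | succ D ih =>
    refine ⟨ih hc, ?_⟩
    cases j with
    | zero =>
      have : mulDiff (fun n : ℕ => c ^ n.choose 0) = 1 := by ext n; simp [mulDiff]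
      rw [this]
      exact one_mem _
    | succ j =>
      have : mulDiff (fun n : ℕ => c ^ n.choose (j + 1)) = fun n : ℕ => c ^ n.choose j := by
        ext n
        simp only [mulDiff, Nat.choose_succ_succ', Nat.add_comm (n.choose j), pow_add,
          inv_mul_cancel_left]
      rw [this]
      exact ih (by rwa [Nat.add_right_comm])

/-- Under these vanishing conditions the $j$-th difference at $0$ is $g(j)$ itself. -/
theorem apply_mem_of_forall_lt_eq_one {D i j : ℕ} (hj : j ≤ D) {g : ℕ → G}
    (hg : g ∈ (polySeq F hF D).1 i) (h : ∀ m < j, g m = 1) : g j ∈ F (i + j) := by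
  induction j generalizing D i g with
  | zero => exact apply_mem_of_mem_polySeq hF hg 0
  | succ j ih =>
    obtain ⟨D, rfl⟩ : ∃ D', D = D' + 1 := ⟨D - 1, by omega⟩
    have := ih (by omega) hg.2 fun m hm => by
      simp [mulDiff, h m (by omega), h (m + 1) (by omega)]
    simp only [mulDiff, h j (by omega), inv_one, one_mul] at this
    rwa [show i + (j + 1) = i + 1 + j by omega]

/-- A polynomial sequence that is trivial on `0, …, j - 1` has its value at `n` in every subgroup
containing all `c ^ n.choose i` with `i ≥ j` and `c ∈ F i`. -/
theorem apply_mem_of_pow_choose_mem {n : ℕ} {W : Subgroup G} {j : ℕ}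
    (hW : ∀ i, j ≤ i → ∀ c ∈ F i, c ^ n.choose i ∈ W) {g : ℕ → G}
    (hg : g ∈ (polySeq F hF n).1 0) (h : ∀ m < j, g m = 1) : g n ∈ W := by
  by_cases hjn : n < j
  · rw [h n hjn]; exact one_mem W
  · have hc : g j ∈ F (0 + j) := apply_mem_of_forall_lt_eq_one hF (by omega) hg h
    have hs := pow_choose_mem_polySeq hF n hc
    -- Peel off the $j$-th Taylor factor; the remaining sequence is trivial on $0,\dots,j$.
    have key : ((fun m : ℕ => g j ^ m.choose j)⁻¹ * g) n ∈ W := by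
      refine apply_mem_of_pow_choose_mem (j := j + 1) (fun i hi => hW i (by omega))
        (mul_mem (inv_mem hs) hg) fun m hm => ?_
      rcases Nat.lt_succ_iff_lt_or_eq.1 hm with hm | rfl
      · simp [h m hm, Nat.choose_eq_zero_of_lt hm]
      · simp
    have hcn := hW j le_rfl (g j) (by simpa using hc)
    simpa using mul_mem hcn key
termination_by n + 1 - j

end mulDiff

/-! ### The lower central series is a filtration -/

section lowerCentralSeries

variable {G : Type*} [Group G]

/-- The three subgroups lemma, applied in the quotient by $N$. -/
theorem commutator_commutator_le_of_rotate {H₁ H₂ H₃ N : Subgroup G} [N.Normal]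
    (h₁ : ⁅⁅H₂, H₃⁆, H₁⁆ ≤ N) (h₂ : ⁅⁅H₃, H₁⁆, H₂⁆ ≤ N) : ⁅⁅H₁, H₂⁆, H₃⁆ ≤ N := by
  have key : ∀ K : Subgroup G, K ≤ N ↔ K.map (QuotientGroup.mk' N) = ⊥ := fun K => by
    rw [Subgroup.map_eq_bot_iff, QuotientGroup.ker_mk']
  rw [key] at h₁ h₂ ⊢
  simp only [map_commutator] at h₁ h₂ ⊢
  exact commutator_commutator_eq_bot_of_rotate h₁ h₂

theorem commutator_top_lowerCentralSeries_le (i j : ℕ) :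
    ⁅(⊤ : Subgroup G).lowerCentralSeries i, (⊤ : Subgroup G).lowerCentralSeries j⁆ ≤
      (⊤ : Subgroup G).lowerCentralSeries (i + j + 1) := by
  induction j generalizing i with
  | zero => exact le_rfl
  | succ j ih =>
    rw [commutator_comm, Subgroup.lowerCentralSeries_succ]
    refine commutator_commutator_le_of_rotate ?_ ?_
    · rw [commutator_comm ⊤, ← Subgroup.lowerCentralSeries_succ]
      refine (ih (i + 1)).trans (le_of_eq ?_)
      congr 1; omega
    · exact commutator_mono (ih i) le_rfl

theorem commutator_lowerCentralSeries_le (S : Subgroup G) (i j : ℕ) :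
    ⁅S.lowerCentralSeries i, S.lowerCentralSeries j⁆ ≤ S.lowerCentralSeries (i + j + 1) := by
  rw [← top_subtype_lowerCentralSeries S i, ← top_subtype_lowerCentralSeries S j,
    ← top_subtype_lowerCentralSeries S (i + j + 1), ← map_commutator]
  exact map_mono (commutator_top_lowerCentralSeries_le i j)

/-- The shift restores the classical indexing from $1$; truncated subtraction makes the terms at $0$
and $1$ both equal to `S`. -/
theorem isGroupFiltration_lowerCentralSeries (S : Subgroup G) :
    IsGroupFiltration fun i => S.lowerCentralSeries (i - 1) where
  antitone := fun _ _ h => S.lowerCentralSeries_antitone (by omega)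
  commutator_mem := fun {i j} _ _ ha hb =>
    S.lowerCentralSeries_antitone (show i + j - 1 ≤ i - 1 + (j - 1) + 1 by omega)
      (commutator_lowerCentralSeries_le S _ _ (commutator_mem_commutator ha hb))

/-- A weak form of the Hall–Petrescu identity. -/
theorem pow_mul_pow_mem_of_pow_choose_mem {x y : G} {W : Subgroup G} {n : ℕ}
    (hW : ∀ i, 2 ≤ i → ∀ c ∈ (closure {x, y}).lowerCentralSeries (i - 1), c ^ n.choose i ∈ W) :
    ((x * y) ^ n)⁻¹ * (x ^ n * y ^ n) ∈ W := by
  have hF := isGroupFiltration_lowerCentralSeries (closure {x, y})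
  have hx : x ∈ closure {x, y} := subset_closure (by simp)
  have hy : y ∈ closure {x, y} := subset_closure (by simp)
  have hpow : ∀ c ∈ closure {x, y}, (fun m : ℕ => c ^ m) ∈ (polySeq _ hF n).1 0 := fun c hc => by
    simpa using pow_choose_mem_polySeq hF n (i := 0) (j := 1) (c := c) (by simpa using hc)
  -- The sequence $(xy)^{-m}x^my^m$ is trivial at $m=0,1$, so only factors with $i\ge 2$ occur.
  refine apply_mem_of_pow_choose_mem hF (j := 2) hW
    (mul_mem (inv_mem (hpow _ (mul_mem hx hy))) (mul_mem (hpow _ hx) (hpow _ hy))) fun m hm => ?_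
  interval_cases m <;> simp

end lowerCentralSeries

/-! ### Relative lower central series -/

section relLowerCentralSeries

variable {H : Type*} [Group H]

/-- The series `N, ⁅N, H⁆, ⁅⁅N, H⁆, H⁆, …` below a subgroup `N` of `H`. -/
def relLowerCentralSeries (N : Subgroup H) : ℕ → Subgroup H
  | 0 => N
  | j + 1 => ⁅relLowerCentralSeries N j, ⊤⁆

variable (N : Subgroup H)

instance relLowerCentralSeries_normal [N.Normal] (j : ℕ) : (relLowerCentralSeries N j).Normal := by
  induction j with
  | zero => assumption
  | succ j ih => exact commutator_normal _ _

theorem relLowerCentralSeries_antitone [N.Normal] : Antitone (relLowerCentralSeries N) :=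
  antitone_nat_of_succ_le fun _ => commutator_le_left _ _

variable {N}

theorem commutator_mem_relLowerCentralSeries {j : ℕ} {g : H}
    (hg : g ∈ relLowerCentralSeries N j) (h : H) : ⁅g, h⁆ ∈ relLowerCentralSeries N (j + 1) :=
  commutator_mem_commutator hg (mem_top h)

variable (N) in
theorem relLowerCentralSeries_le_lowerCentralSeries (j : ℕ) :
    relLowerCentralSeries N j ≤ (⊤ : Subgroup H).lowerCentralSeries j := by
  induction j with
  | zero => exact le_top
  | succ j ih => exact commutator_mono ih le_rfl

theorem commutator_closure_pair_le {x y : H} {M : Subgroup H} [M.Normal] (h : ⁅x, y⁆ ∈ M) :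
    ⁅closure {x, y}, closure {x, y}⁆ ≤ M := by
  rw [← QuotientGroup.ker_mk' M, ← Subgroup.map_eq_bot_iff, map_commutator,
    commutator_eq_bot_iff_le_centralizer, MonoidHom.map_closure, Set.image_pair, closure_le]
  have hc : Commute (QuotientGroup.mk' M x) (QuotientGroup.mk' M y) := by
    rw [← commutatorElement_eq_one_iff_commute, ← map_commutatorElement]
    exact (QuotientGroup.eq_one_iff _).2 h
  rw [centralizer_closure]
  rintro _ (rfl | rfl) <;> rw [SetLike.mem_coe, mem_centralizer_iff] <;> rintro _ (rfl | rfl)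
  exacts [rfl, hc.symm, hc, rfl]

theorem lowerCentralSeries_closure_pair_le [N.Normal] {x y : H} {s : ℕ}
    (h : ⁅x, y⁆ ∈ relLowerCentralSeries N (s + 1)) (i : ℕ) :
    (closure {x, y}).lowerCentralSeries (i + 1) ≤ relLowerCentralSeries N (s + i + 1) := by
  induction i with
  | zero => exact commutator_closure_pair_le h
  | succ i ih => exact commutator_mono ih le_top

theorem pow_mul_pow_mem_of_commutator_mem [N.Normal] {x y : H} {s n : ℕ} {W : Subgroup H}
    (h : ⁅x, y⁆ ∈ relLowerCentralSeries N (s + 1))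
    (hW : ∀ i, ∀ c ∈ relLowerCentralSeries N (s + i + 1), c ^ n.choose (i + 2) ∈ W) :
    ((x * y) ^ n)⁻¹ * (x ^ n * y ^ n) ∈ W := by
  refine pow_mul_pow_mem_of_pow_choose_mem fun i hi c hc => ?_
  obtain ⟨i, rfl⟩ := Nat.exists_eq_add_of_le' hi
  exact hW i c (lowerCentralSeries_closure_pair_le h i hc)

/-- If the powers `c ^ n.choose (i + 2)` with `c` deep in the series lie in `W`, then modulo `W`
the `n`-th power of a commutator with `l` is trivial exactly when that of `l` is centralized. -/
theorem commutator_pow_mem_iff [N.Normal] {l x : H} {w n : ℕ} {W : Subgroup H}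
    (hl : ⁅l, x⁆ ∈ relLowerCentralSeries N w)
    (hW : ∀ i, ∀ c ∈ relLowerCentralSeries N (w + i + 1), c ^ n.choose (i + 2) ∈ W) :
    ⁅l, x⁆ ^ n ∈ W ↔ ⁅l ^ n, x⁆ ∈ W := by
  -- Split $[l,x]=l\cdot xl^{-1}x^{-1}$. The two factors have commutator $[[l,x],l^{-1}]$, and their
  -- $n$-th powers multiply to $[l^n,x]$.
  have hcomm : ⁅l, x * l⁻¹ * x⁻¹⁆ ∈ relLowerCentralSeries N (w + 1) := by
    have := commutator_mem_relLowerCentralSeries hl l⁻¹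
    convert this using 1
    simp [commutatorElement_def, mul_assoc]
  have key := pow_mul_pow_mem_of_commutator_mem hcomm hW
  have e₁ : l * (x * l⁻¹ * x⁻¹) = ⁅l, x⁆ := by simp [commutatorElement_def, mul_assoc]
  have e₂ : l ^ n * (x * l⁻¹ * x⁻¹) ^ n = ⁅l ^ n, x⁆ := by
    rw [conj_pow, inv_pow, commutatorElement_def, mul_assoc, mul_assoc, mul_assoc]
  rw [e₁, e₂] at key
  constructor
  · intro h; simpa using mul_mem h key
  · intro h; simpa only [mul_inv_rev, inv_inv, mul_inv_cancel_left] using mul_mem h (inv_mem key)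

end relLowerCentralSeries

/-! ### Powers in the relative lower central series -/

/-- If $p^v$ exactly divides $i+1$, then $(i+1)\binom{p^s}{i+1}=p^s\binom{p^s-1}{i}$ loses only
$p^v$, and $v(p-1)\le p^v-1\le i$. -/
theorem prime_pow_dvd_choose {p : ℕ} (hp : p.Prime) {m t i : ℕ} (hi : i ≤ t) :
    p ^ (m + (t - i) / (p - 1)) ∣ (p ^ (m + t / (p - 1))).choose (i + 1) := by
  set s := m + t / (p - 1) with hs
  have hp1 : 0 < p - 1 := by have := hp.two_le; omega
  obtain ⟨v, u, hu, hvu⟩ := Nat.exists_eq_pow_mul_and_not_dvd (Nat.succ_ne_zero i) p hp.ne_one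
  have hmul : (i + 1) * (p ^ s).choose (i + 1) = p ^ s * (p ^ s - 1).choose i := by
    have hpos : 0 < p ^ s := pow_pos hp.pos s
    have := Nat.add_one_mul_choose_eq (p ^ s - 1) i
    rw [Nat.sub_add_cancel hpos] at this
    rw [this, mul_comm]
  have hv : v * (p - 1) ≤ i := by
    have h1 : v * (p - 1) + 1 ≤ p ^ v := by
      obtain ⟨q, rfl⟩ : ∃ q, p = q + 1 := ⟨p - 1, by omega⟩
      rw [Nat.add_sub_cancel]
      clear * -
      induction v with
      | zero => simp
      | succ v ih => rw [pow_succ]; nlinarith [Nat.zero_le (v * q * q)]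
    have h2 : p ^ v ≤ i + 1 := Nat.le_of_dvd (Nat.succ_pos i) ⟨u, hvu⟩
    omega
  have hle : m + (t - i) / (p - 1) + v ≤ s := by
    have : (t - i) / (p - 1) + v ≤ t / (p - 1) := by
      rw [← Nat.add_mul_div_right _ _ hp1]
      exact Nat.div_le_div_right (by omega)
    omega
  have hdvd : p ^ v * p ^ (m + (t - i) / (p - 1)) ∣ p ^ v * (u * (p ^ s).choose (i + 1)) := by
    rw [← mul_assoc, ← hvu, ← pow_add]
    change _ ∣ (i + 1) * _
    rw [hmul]
    exact (pow_dvd_pow p (by omega)).mul_right _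
  have := Nat.dvd_of_mul_dvd_mul_left (pow_pos hp.pos v) hdvd
  exact (((hp.coprime_iff_not_dvd.2 hu).pow_left _)).dvd_of_dvd_mul_left this

section centralPower

variable {H : Type*} [Group H] {p m : ℕ} {b : H}

/-- The elements that are central modulo $A$ form a normal subgroup. -/
theorem normalClosure_commutator_mem {B : Set H} {A : Subgroup H} [A.Normal]
    (h : ∀ b ∈ B, ∀ x, ⁅b, x⁆ ∈ A) {l : H} (hl : l ∈ normalClosure B) (x : H) : ⁅l, x⁆ ∈ A := by
  have key : ∀ l : H, l ∈ (center (H ⧸ A)).comap (QuotientGroup.mk' A) ↔ ∀ x, ⁅l, x⁆ ∈ A := by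
    intro l
    rw [mem_comap, mem_center_iff, (QuotientGroup.mk'_surjective A).forall]
    refine forall_congr' fun y => ?_
    rw [← QuotientGroup.eq_one_iff, ← QuotientGroup.mk'_apply, map_commutatorElement,
      commutatorElement_eq_one_iff_mul_comm, eq_comm]
  have : normalClosure B ≤ (center (H ⧸ A)).comap (QuotientGroup.mk' A) :=
    normalClosure_le_normal fun b hb => (key b).2 (h b hb)
  exact (key l).1 (this hl) x

/-- If `b ^ p ^ m` is central, then powers of `p` push the series
`⟨b⟩ᴴ, ⁅⟨b⟩ᴴ, H⁆, …` down, with exponents that grow by one for every `p - 1` steps. -/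
theorem pow_mem_relLowerCentralSeries (hp : p.Prime) (hb : b ^ p ^ m ∈ center H) (t w : ℕ) :
    ∀ g ∈ relLowerCentralSeries (normalClosure {b}) (w + 1),
      g ^ p ^ (m + t / (p - 1)) ∈ relLowerCentralSeries (normalClosure {b}) (w + t + 2) := by
  induction t using Nat.strong_induction_on generalizing w with
  | _ t iht =>
  induction w using Nat.strong_induction_on with
  | _ w ihw =>
  set N := relLowerCentralSeries (normalClosure {b})
  set n := p ^ (m + t / (p - 1)) with hn
  have hanti : Antitone N := relLowerCentralSeries_antitone _
  -- Error terms: for $i+1\le t$ the binomial is divisible by the power of $p$ belonging to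
  -- $t-(i+1)$, and induction on $t$ applies; otherwise $c$ is already deep enough.
  have hW : ∀ i, ∀ c ∈ N (w + 1 + i + 1), c ^ n.choose (i + 2) ∈ N (w + t + 2) := by
    intro i c hc
    by_cases hit : i + 1 ≤ t
    · obtain ⟨d, hd⟩ := prime_pow_dvd_choose hp (m := m) hit
      rw [← hn] at hd
      rw [hd, pow_mul]
      have := iht (t - (i + 1)) (by omega) (w + i + 1) c
        (by rwa [show w + i + 1 + 1 = w + 1 + i + 1 by omega])
      rw [show w + i + 1 + (t - (i + 1)) + 2 = w + t + 2 by omega] at this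
      exact pow_mem this d
    · exact pow_mem (hanti (by omega) hc) _
  -- By `hW`, taking $n$-th powers is multiplicative on $N_{w+1}$ modulo $N_{w+t+2}$. Hence `A` is a
  -- subgroup and only commutators $[l,x]$ with $l\in N_w$ need checking.
  let A : Subgroup H :=
    { carrier := {g | g ∈ N (w + 1) ∧ g ^ n ∈ N (w + t + 2)}
      one_mem' := ⟨one_mem _, by rw [one_pow]; exact one_mem _⟩
      mul_mem' := by
        rintro x y ⟨hx, hx'⟩ ⟨hy, hy'⟩
        refine ⟨mul_mem hx hy, ?_⟩
        have key := pow_mul_pow_mem_of_commutator_mem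
          (commutator_mem_relLowerCentralSeries hx y) hW
        rwa [← inv_mem_iff, mul_inv_rev, inv_inv, mul_mem_cancel_left
          (inv_mem (mul_mem hx' hy'))] at key
      inv_mem' := by
        rintro x ⟨hx, hx'⟩
        exact ⟨inv_mem hx, by rw [inv_pow]; exact inv_mem hx'⟩ }
  have hA : A.Normal := ⟨fun x hx y =>
    ⟨(relLowerCentralSeries_normal _ _).conj_mem x hx.1 y, by
      rw [conj_pow]; exact (relLowerCentralSeries_normal _ _).conj_mem _ hx.2 y⟩⟩
  suffices N (w + 1) ≤ A from fun g hg => (this hg).2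
  change ⁅N w, ⊤⁆ ≤ A
  refine commutator_le.2 fun l hl x _ => ?_
  cases w with
  -- For $w=0$ it suffices to take $l=b$, where $[b^n,y]=1$; for $w>0$, $l^n$ is deep by induction
  -- on $w$, and commuting with $x$ gains one more step.
  | zero =>
    refine normalClosure_commutator_mem (B := {b}) ?_ hl x
    intro b' hb' y
    rw [Set.mem_singleton_iff.1 hb']
    have hby : ⁅b, y⁆ ∈ N (0 + 1) :=
      commutator_mem_relLowerCentralSeries (subset_normalClosure (Set.mem_singleton b)) y
    refine ⟨hby, (commutator_pow_mem_iff hby hW).2 ?_⟩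
    have hbn : b ^ n ∈ center H := by
      rw [hn, pow_add, pow_mul]
      exact pow_mem hb _
    rw [commutatorElement_eq_one_iff_mul_comm.2 (mem_center_iff.1 hbn y).symm]
    exact one_mem _
  | succ w =>
    have hlx : ⁅l, x⁆ ∈ N (w + 1 + 1) := commutator_mem_relLowerCentralSeries hl x
    refine ⟨hlx, (commutator_pow_mem_iff hlx hW).2 ?_⟩
    have : ⁅l ^ n, x⁆ ∈ N (w + t + 2 + 1) :=
      commutator_mem_relLowerCentralSeries (ihw w (Nat.lt_succ_self w) l hl) x
    rwa [show w + 1 + t + 2 = w + t + 2 + 1 by omega]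

/-- In a group of class at most `k + 1`, if `b ^ p ^ m` is central then every
`p ^ (m + (k - 1) / (p - 1))`-th power commutes with `b`. -/
theorem commute_pow_of_pow_mem_center (hp : p.Prime) {k : ℕ} (hk : 1 ≤ k)
    (hH : (⊤ : Subgroup H).lowerCentralSeries (k + 1) = ⊥) (hb : b ^ p ^ m ∈ center H) (a : H) :
    Commute (a ^ p ^ (m + (k - 1) / (p - 1))) b := by
  set N := relLowerCentralSeries (normalClosure {b})
  set n := p ^ (m + (k - 1) / (p - 1)) with hn
  have hbot : N (k + 1) = ⊥ :=
    le_bot_iff.1 (hH ▸ relLowerCentralSeries_le_lowerCentralSeries _ (k + 1))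
  have hanti : Antitone N := relLowerCentralSeries_antitone _
  have hab : ⁅a, b⁆ ∈ N (0 + 1) := by
    rw [← commutatorElement_inv]
    exact inv_mem (commutator_mem_relLowerCentralSeries
      (subset_normalClosure (Set.mem_singleton b)) a)
  have hW : ∀ i, ∀ c ∈ N (0 + 1 + i + 1), c ^ n.choose (i + 2) ∈ N (k + 1) := by
    intro i c hc
    by_cases hit : i + 1 ≤ k - 1
    · obtain ⟨d, hd⟩ := prime_pow_dvd_choose hp (m := m) hit
      rw [← hn] at hd
      rw [hd, pow_mul]
      have := pow_mem_relLowerCentralSeries hp hb (k - 1 - (i + 1)) (i + 1) c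
        (by rwa [show i + 1 + 1 = 0 + 1 + i + 1 by omega])
      rw [show i + 1 + (k - 1 - (i + 1)) + 2 = k + 1 by omega] at this
      exact pow_mem this d
    · exact pow_mem (hanti (by omega) hc) _
  -- With $w=0$ and $t=k-1$ the target is $N_{k+1}$, which is trivial.
  have h0 : ⁅a, b⁆ ^ n ∈ N (k + 1) := by
    have := pow_mem_relLowerCentralSeries hp hb (k - 1) 0 _ hab
    rwa [show 0 + (k - 1) + 2 = k + 1 by omega] at this
  have := (commutator_pow_mem_iff hab hW).1 h0
  rw [hbot, mem_bot] at this
  exact commutatorElement_eq_one_iff_commute.1 this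

end centralPower

/-! ### Capable groups -/

/-- Since $\ker f$ is central, $H$ is generated by the lifts together with central elements. -/
theorem mem_center_of_forall_commute_lift {H G : Type*} [Group H] [Group G] {ι : Type*}
    {f : H →* G} (hf : f.ker ≤ center H) {x : ι → G} (hx : closure (Set.range x) = ⊤) {y : ι → H}
    (hy : ∀ i, f (y i) = x i) {h : H} (hh : ∀ i, Commute h (y i)) : h ∈ center H := by
  have hmap : (centralizer {h}).map f = ⊤ := by
    rw [eq_top_iff, ← hx, closure_le]
    rintro _ ⟨i, rfl⟩
    exact ⟨y i, mem_centralizer_singleton_iff.2 (hh i).symm, hy i⟩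
  rw [mem_center_iff]
  intro g
  obtain ⟨c, hc, hcg⟩ : f g ∈ (centralizer {h}).map f := hmap ▸ mem_top _
  have hz : c⁻¹ * g ∈ center H := hf (by rw [MonoidHom.mem_ker, map_mul, map_inv, hcg]; simp)
  have hg : g ∈ centralizer {h} := by
    have := mul_mem hc (center_le_centralizer {h} hz)
    rwa [mul_inv_cancel_left] at this
  exact mem_centralizer_singleton_iff.1 hg

theorem top_lowerCentralSeries_succ_eq_bot_of_ker_le_center {H G : Type*} [Group H] [Group G]
    {f : H →* G} (hf : f.ker ≤ center H) {k : ℕ}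
    (hG : (⊤ : Subgroup G).lowerCentralSeries k = ⊥) :
    (⊤ : Subgroup H).lowerCentralSeries (k + 1) = ⊥ := by
  rw [Subgroup.lowerCentralSeries_succ, commutator_top_right_eq_bot_iff_le_center]
  refine le_trans ?_ hf
  rw [← Subgroup.map_eq_bot_iff, map_lowerCentralSeries, ← le_bot_iff, ← hG]
  exact lowerCentralSeries_mono k le_top

/-- The index `⟨r - 1, _⟩ : Fin r` is the last generator and `⟨r - 2, _⟩` the last but one.
As `1 ≤ k` and `2 ≤ p`, the natural number `(k - 1) / (p - 1)` is the floor of the quotient. -/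
theorem mainTheorem1 (k p : ℕ) (hk : 1 ≤ k) (hp : p.Prime)
    (G : Type u) [Group G] [Nontrivial G] (hG : IsPGroup p G)
    [Group.IsNilpotent G] (hclass : Group.nilpotencyClass G ≤ k)
    (r : ℕ) (x : Fin r → G) (hx : IsMinimalGenerating x)
    (α : Fin r → ℕ) (hα : ∀ i, orderOf (x i) = p ^ α i) (hmono : Monotone α)
    (hcap : IsCapable.{u, v} G) :
    ∃ hr : 1 < r,
      α ⟨r - 1, by omega⟩ ≤ α ⟨r - 2, by omega⟩ + (k - 1) / (p - 1) ∧
      (k < p → α ⟨r - 1, by omega⟩ = α ⟨r - 2, by omega⟩) := by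
  obtain ⟨H, _, ⟨e⟩⟩ := hcap
  let f : H →* G := e.symm.toMonoidHom.comp (QuotientGroup.mk' (center H))
  have hfx : ∀ g, f g = e.symm (QuotientGroup.mk' (center H) g) := fun _ => rfl
  have hker : ∀ g, f g = 1 ↔ g ∈ center H := fun g => by
    rw [hfx, EmbeddingLike.map_eq_one_iff, QuotientGroup.mk'_apply, QuotientGroup.eq_one_iff]
  have hf : f.ker ≤ center H := fun g hg => (hker g).1 hg
  have hsurj : Function.Surjective f :=
    e.symm.surjective.comp (QuotientGroup.mk'_surjective _)
  have hgen : closure (Set.range x) = ⊤ := hx.2.prop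
  have hlcs : (⊤ : Subgroup H).lowerCentralSeries (k + 1) = ⊥ :=
    top_lowerCentralSeries_succ_eq_bot_of_ker_le_center hf
      (Subgroup.lowerCentralSeries_eq_bot_iff_nilpotencyClass_le.2 hclass)
  choose y hy using fun i => hsurj (x i)
  have hr : 1 < r := by
    by_contra hr
    have : Subsingleton (Fin r) := Fin.subsingleton_iff_le_one.2 (by omega)
    -- A single lift commutes with itself, hence is central, so its image is trivial.
    have hx1 : ∀ i, x i = 1 := fun i => by
      rw [← hy, hker]
      refine mem_center_of_forall_commute_lift hf hgen hy fun j => ?_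
      rw [Subsingleton.elim j i]
    have htriv : (⊤ : Subgroup G) = ⊥ := by
      rw [← hgen, closure_eq_bot_iff]
      rintro _ ⟨i, rfl⟩
      exact hx1 i
    exact top_ne_bot htriv
  have hbound : α ⟨r - 1, by omega⟩ ≤ α ⟨r - 2, by omega⟩ + (k - 1) / (p - 1) := by
    set a := y ⟨r - 1, by omega⟩ with ha
    have hcen : a ^ p ^ (α ⟨r - 2, by omega⟩ + (k - 1) / (p - 1)) ∈ center H := by
      refine mem_center_of_forall_commute_lift hf hgen hy fun i => ?_
      by_cases hi : i = ⟨r - 1, by omega⟩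
      · rw [hi]
        exact Commute.pow_self _ _
      · have hile : i ≤ ⟨r - 2, by omega⟩ := by
          rw [Fin.ext_iff] at hi
          rw [Fin.le_def]
          simp only at hi ⊢
          omega
        refine commute_pow_of_pow_mem_center hp hk hlcs ?_ a
        rw [← hker, map_pow, hy, ← orderOf_dvd_iff_pow_eq_one, hα]
        exact pow_dvd_pow p (hmono hile)
    rw [← hker, map_pow, ha, hy, ← orderOf_dvd_iff_pow_eq_one, hα] at hcen
    exact (Nat.pow_dvd_pow_iff_le_right hp.one_lt).1 hcen
  refine ⟨hr, hbound, fun hkp => le_antisymm ?_ (hmono ?_)⟩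
  · rwa [Nat.div_eq_of_lt (by omega), add_zero] at hbound
  · rw [Fin.le_def]
    simp only
    omega
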